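/- Let $f_0:(-\pi,\pi]\times\mathbb R\to\mathbb R$, $(q,p)\mapsto f_0(q,p)$, be measurable, bounded, even in $p$, and $C^\infty$ in $p$ for every $q$, and suppose that for every $R>0$ the partial derivatives $f_0^{(n)}=\partial_p^n f_0$, $n\le 4$, are bounded on $(-\pi,\pi]\times[-R,R]$. Put $\mu=(-\pi,\pi]\times\mathbb R$. For $\bar M>0$ let $\langle\cos q\rangle_J(q,p)$ be the average of $\cos$ over the orbit through $(q,p)$ of the pendulum Hamiltonian $H=p^2/2-\bar M\cos q$, taken with respect to the angle variable $\theta$. Explicitly, $d\theta\propto dx/|y|$ on the orbit with points $(x,y)$, so that with $E=H(q,p)$ $$\langle\cos q\rangle_J=\frac{\int \cos x\,\bigl(2(E+\bar M\cos x)\bigr)^{-1/2}dx}{\int \bigl(2(E+\bar M\cos x)\bigr)^{-1/2}dx},$$ both integrals being over $\{x\in(-\pi,\pi]: E+\bar M\cos x>0\}$; this is defined off the null set $E\in\{-\bar M,\bar M\}$. It depends only on the modulus $k=\sqrt{(p^2+2\bar M(1-\cos q))/(4\bar M)}$, and we write it $C(k)$ when it is regarded as a function of $k$. Let $$I(\bar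 M)=\iint_\mu \langle\cos q\rangle_J\, f_0(q,p)\,dq\,dp ,$$ $$L_{1/2}=\bar M^{-1/2}\iint_\mu f_0(q,0)\langle\cos q\rangle_J\,dq\,dp,\qquad L_1=-\frac12\iint_\mu \frac{f_0^{(1)}(q,p)}{p}\,dq\,dp,$$ $$L_{3/2}=\bar M^{-3/2}\iint_\mu f_0^{(2)}(q,0)\Bigl(\frac{p^2}{2}\langle\cos q\rangle_J+\frac{\bar M}{4}\Bigr)dq\,dp .$$ Here the integral in $L_1$ is improper, namely the limit as $R\to\infty$ of the integrals over $|p|<R$; it is the Lebesgue integral whenever $f_0^{(1)}/p$ is integrable on $\mu$. Then: 1. The integrals defining $I$, $L_{1/2}$ and $L_{3/2}$ converge absolutely for every $\bar M>0$; those over $|p|<R$ in $L_1$ converge absolutely for every $R$, and their limit as $R\to\infty$ exists. 2. $L_{1/2}$ and $L_{3/2}$ do not depend on $\bar M$: with $q_{\max}=2\arcsin k$, for $j\in\{1/2,3/2\}$ $$L_j=4\Bigl(\int_0^1dk\int_{-q_{\max}}^{q_{\max}}dq+\int_1^\infty dk\int_{-\pi}^{\pi}dq\Bigr)\psi_j(q,k),$$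 $$\psi_{1/2}=\frac{f_0(q,0)\,C(k)}{\sqrt{1-k^{-2}\sin^2(q/2)}},\qquad \psi_{3/2}=\frac{f_0^{(2)}(q,0)\bigl[(2k^2-1+\cos q)\,C(k)+1/4\bigr]}{\sqrt{1-k^{-2}\sin^2(q/2)}}.$$ 3. As $\bar M\to0^+$, $$I(\bar M)=L_{1/2}\,\bar M^{1/2}+L_1\,\bar M+L_{3/2}\,\bar M^{3/2}+O(\bar M^{7/4}).$$ 4. Consequently there are constants $C_0$ and $\delta>0$ such that for all $M>0$, $h\ge0$ with $\bar M=M+h<\delta$ which satisfy the self-consistent equation $M=I(\bar M)$, $$\bigl|M-\bigl(L_{1/2}\,\bar M^{1/2}+L_1\,\bar M+L_{3/2}\,\bar M^{3/2}\bigr)\bigr|\le C_0\,\bar M^{7/4}.$$ -/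

import Mathlib

open Real Set Filter Topology MeasureTheory Asymptotics
open scoped ContDiff

noncomputable section

/-- The phase space `(-π, π] × ℝ`, with points `(q, p)`. -/
def phaseSpace : Set (ℝ × ℝ) := Ioc (-π) π ×ˢ univ

/-- The pendulum Hamiltonian `p² / 2 - M cos q`. -/
def pendulumEnergy (M q p : ℝ) : ℝ := p ^ 2 / 2 - M * cos q

/-- The nonnegative momentum at position `x` on the level `E` of the pendulum Hamiltonian. -/
def levelMomentum (M E x : ℝ) : ℝ := √(2 * (E + M * cos x))

/-- The positions `x` at which the level `E` has two distinct momenta `± levelMomentum M E x`. -/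
def levelPositions (M E : ℝ) : Set ℝ := {x ∈ Ioc (-π) π | 0 < E + M * cos x}

/-- The average `⟨ψ⟩_J` at the point `(q, p)`: the mean of `ψ` over the orbit of the pendulum
through `(q, p)`, with respect to the angle variable `θ`. In one degree of freedom the angle
is `θ = Ω ∫ dx / p` along the orbit (it is proportional to the time), so that `dθ` is
`Ω |p|⁻¹ dx` and the total angle `2π` is the integral of `dθ` over the whole orbit.

* For `E > M` (outside the separatrix) the orbit is one branch of the level set, on which the
  momentum keeps the sign of `p`.
* For `E < M` (inside the separatrix) the orbit is a closed curve made of the two branches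
  `p = ± levelMomentum M E x`.

On the separatrix `E = M` and at the stable equilibrium `E = -M`, where there is no angle
variable, the value is without significance (for positive `M` this set is null). -/
def angleAverage (M : ℝ) (ψ : ℝ → ℝ → ℝ) (q p : ℝ) : ℝ :=
  let E := pendulumEnergy M q p
  if M < E then
    (∫ x in levelPositions M E,
        ψ x (SignType.sign p * levelMomentum M E x) / levelMomentum M E x) /
      ∫ x in levelPositions M E, 1 / levelMomentum M E x
  else
    (∫ x in levelPositions M E,
        (ψ x (levelMomentum M E x) + ψ x (-levelMomentum M E x)) / levelMomentum M E x) /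
      ∫ x in levelPositions M E, 2 / levelMomentum M E x

/-- `⟨cos q⟩_J` at `(q, p)`, for the pendulum Hamiltonian `p² / 2 - M cos q`. -/
def cosAverage (M q p : ℝ) : ℝ := angleAverage M (fun x _ => cos x) q p

/-- `⟨cos q⟩_J` as a function of the modulus `k = √((p² + 2 M (1 - cos q)) / (4 M))`: its value
for `M = 1` at the point `(0, 2 k)`, whose modulus is `k`. -/
def cosAverageModulus (k : ℝ) : ℝ := cosAverage 1 0 (2 * k)

/-- The `n`-th partial derivative of `f` with respect to `p`. -/
def pDeriv (n : ℕ) (f : ℝ → ℝ → ℝ) (q p : ℝ) : ℝ := iteratedDeriv n (f q) p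

/-- The assumptions on the initial distribution: it is even in `p`, smooth in `p` and bounded.
The last field says that the partial derivatives in `p` up to the fourth are bounded on each
rectangle `(-π, π] × [-R, R]`. -/
structure AdmissibleInitial (f : ℝ → ℝ → ℝ) : Prop where
  measurable : Measurable (Function.uncurry f)
  even : ∀ q ∈ Ioc (-π) π, ∀ p, f q (-p) = f q p
  smooth : ∀ q ∈ Ioc (-π) π, ContDiff ℝ ∞ (f q)
  bounded : ∃ C, ∀ q ∈ Ioc (-π) π, ∀ p, |f q p| ≤ C
  deriv_bounded : ∀ n ≤ 4, ∀ R : ℝ, ∃ C, ∀ q ∈ Ioc (-π) π, ∀ p, |p| ≤ R → |pDeriv n f q p| ≤ C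

/-- The integral `I = ∬ ⟨cos q⟩_J f dq dp` over the phase space. -/
def magnetizationIntegral (f : ℝ → ℝ → ℝ) (M : ℝ) : ℝ :=
  ∫ z in phaseSpace, cosAverage M z.1 z.2 * f z.1 z.2

/-- The coefficient `L_{1/2}[f] = M^{-1/2} ∬ f(q, 0) ⟨cos q⟩_J dq dp`. -/
def coeffHalf (f : ℝ → ℝ → ℝ) (M : ℝ) : ℝ :=
  M ^ (-(1 / 2) : ℝ) * ∫ z in phaseSpace, f z.1 0 * cosAverage M z.1 z.2

/-- `-(1/2) ∬ f⁽¹⁾(q, p) / p dq dp` over the part `|p| < R` of the phase space. -/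
def coeffOneTruncated (f : ℝ → ℝ → ℝ) (R : ℝ) : ℝ :=
  -(1 / 2) * ∫ z in Ioc (-π) π ×ˢ Ioo (-R) R, pDeriv 1 f z.1 z.2 / z.2

/-- The coefficient `L_1[f] = -(1/2) ∬ f⁽¹⁾(q, p) / p dq dp`, where the integral is improper at
`|p| = ∞`. -/
def coeffOne (f : ℝ → ℝ → ℝ) : ℝ := limUnder atTop (coeffOneTruncated f)

/-- The coefficient
`L_{3/2}[f] = M^{-3/2} ∬ f⁽²⁾(q, 0) ((p² / 2) ⟨cos q⟩_J + M / 4) dq dp`. -/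
def coeffThreeHalves (f : ℝ → ℝ → ℝ) (M : ℝ) : ℝ :=
  M ^ (-(3 / 2) : ℝ) * ∫ z in phaseSpace,
    pDeriv 2 f z.1 0 * (z.2 ^ 2 / 2 * cosAverage M z.1 z.2 + M / 4)

/-- The integrand of `L_{1/2}` in the variables `(q, k)`. -/
def psiHalf (f : ℝ → ℝ → ℝ) (q k : ℝ) : ℝ :=
  f q 0 * cosAverageModulus k / √(1 - sin (q / 2) ^ 2 / k ^ 2)

/-- The integrand of `L_{3/2}` in the variables `(q, k)`. -/
def psiThreeHalves (f : ℝ → ℝ → ℝ) (q k : ℝ) : ℝ :=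
  pDeriv 2 f q 0 * ((2 * k ^ 2 - 1 + cos q) * cosAverageModulus k + 1 / 4) /
    √(1 - sin (q / 2) ^ 2 / k ^ 2)

/-- The integral over the region of the `(q, k)` half-plane swept by the orbits: `|q| < q_max`
with `q_max = 2 arcsin k` for `k < 1`, and `|q| < π` for `k > 1`. -/
def modulusIntegral (ψ : ℝ → ℝ → ℝ) : ℝ :=
  (∫ k in Ioo (0 : ℝ) 1, ∫ q in (-(2 * arcsin k))..(2 * arcsin k), ψ q k) +
    ∫ k in Ioi (1 : ℝ), ∫ q in (-π)..π, ψ q k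

/-- The three-term expansion `L_{1/2} M^{1/2} + L_1 M + L_{3/2} M^{3/2}`. -/
def expansion (f : ℝ → ℝ → ℝ) (M : ℝ) : ℝ :=
  coeffHalf f M * M ^ (1 / 2 : ℝ) + coeffOne f * M + coeffThreeHalves f M * M ^ (3 / 2 : ℝ)

end

/-! Write `C` for the averaged cosine at `(q, p)` and `f₀`, `f₂` for `f` and its second
`p`-derivative at `(q, 0)`. The three-term expansion is arranged so that, for every `M > 0`, the
error is exactly ∬ (C + M / (2p²)) (f - f₀ - f₂ p² / 2) dq dp. Multiplying out gives `I`, the terms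
with `C f₀` and with `f₂ (p² C / 2 + M / 4)`, which are the half and three-halves terms, and `(M /
2) ∬ (f - f₀) / p²`, which is `-L₁ M` after an integration by parts in `p`
(`integral_pDeriv_one_div`).

The first factor is at most `100 M² / p⁴` for all `p ≠ 0` (`abs_cosAverage_add_le`): after scaling
to `M = 1` this is the high-energy behaviour of the average, and at low energy the trivial bound
`|C| ≤ 1` suffices. The second is at most `K p⁴ / (1 + p²)` (`exists_abs_sub_taylor_le`), by
Taylor's formula for an even function near `p = 0` and by boundedness far away. The powers of `p`
cancel, leaving an integrable majorant times `M²`, so the error is even `O(M²)`.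

Independence of `M` comes from replacing `p` by the modulus `k` at fixed `q`, followed by Fubini. -/

/-- The orbit average of `cos` on the level `e` of the pendulum Hamiltonian with `M = 1`. -/
noncomputable def reducedAverage (e : ℝ) : ℝ :=
  (∫ x in levelPositions 1 e, cos x / levelMomentum 1 e x) /
    ∫ x in levelPositions 1 e, 1 / levelMomentum 1 e x

/-! ### Scaling to `M = 1` -/

theorem levelPositions_scale {M : ℝ} (hM : 0 < M) (e : ℝ) :
    levelPositions M (M * e) = levelPositions 1 e := by
  ext x
  have : M * e + M * cos x = M * (e + 1 * cos x) := by ring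
  simp only [levelPositions, mem_ofPred_eq, this, mul_pos_iff_of_pos_left hM]

theorem levelMomentum_scale {M : ℝ} (hM : 0 < M) (e x : ℝ) :
    levelMomentum M (M * e) x = √M * levelMomentum 1 e x := by
  have : 2 * (M * e + M * cos x) = M * (2 * (e + 1 * cos x)) := by ring
  rw [levelMomentum, levelMomentum, this, sqrt_mul hM.le]

/-- With `E = M e` the momentum only acquires a factor `√M`, which cancels in the quotient. Since
`cos` ignores the momentum, the two branches inside the separatrix contribute equally and their
factor 2 cancels too, so one formula serves both cases. -/
theorem cosAverage_eq_reducedAverage {M : ℝ} (hM : 0 < M) (q p : ℝ) :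
    cosAverage M q p = reducedAverage (p ^ 2 / (2 * M) - cos q) := by
  have hE : pendulumEnergy M q p = M * (p ^ 2 / (2 * M) - cos q) := by
    rw [pendulumEnergy]; field_simp
  have hs : √M ≠ 0 := (sqrt_pos.2 hM).ne'
  rw [cosAverage, angleAverage, reducedAverage, hE]
  set e := p ^ 2 / (2 * M) - cos q
  simp only [levelPositions_scale hM, levelMomentum_scale hM]
  have h1 : ∀ c x : ℝ, c / (√M * levelMomentum 1 e x) =
      (√M)⁻¹ * (c / levelMomentum 1 e x) := fun c x => by
    rw [mul_comm √M, ← div_div, div_eq_mul_inv _ √M, mul_comm]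
  have h2 : ∀ x : ℝ, (cos x + cos x) / levelMomentum 1 e x =
      2 * (cos x / levelMomentum 1 e x) := fun x => by ring
  have h3 : ∀ x : ℝ, 2 / levelMomentum 1 e x =
      2 * (1 / levelMomentum 1 e x) := fun x => by ring
  simp only [h1, h2, h3, integral_const_mul]
  split_ifs
  · rw [mul_div_mul_left _ _ (inv_ne_zero hs)]
  · rw [mul_div_mul_left _ _ (inv_ne_zero hs), mul_div_mul_left _ _ two_ne_zero]

theorem levelMomentum_nonneg (M E x : ℝ) : 0 ≤ levelMomentum M E x := sqrt_nonneg _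

theorem abs_reducedAverage_le_one (e : ℝ) : |reducedAverage e| ≤ 1 := by
  rw [reducedAverage]
  by_cases hi : IntegrableOn (fun x => 1 / levelMomentum 1 e x) (levelPositions 1 e)
  · rw [abs_div]
    refine div_le_one_of_le₀ ?_ (abs_nonneg _)
    refine le_trans ?_ (le_abs_self _)
    refine norm_integral_le_of_norm_le (f := fun x => cos x / levelMomentum 1 e x) hi ?_
    refine Eventually.of_forall fun x => ?_
    rw [norm_div, norm_eq_abs, norm_eq_abs, abs_of_nonneg (levelMomentum_nonneg 1 e x)]
    exact div_le_div_of_nonneg_right (abs_cos_le_one x) (levelMomentum_nonneg 1 e x)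
  -- If the weight is not integrable, its integral and the quotient take the default value 0.
  · rw [integral_undef hi, div_zero, abs_zero]
    exact zero_le_one

theorem measurable_reducedAverage : Measurable reducedAverage := by
  have hset : MeasurableSet {z : ℝ × ℝ | z.2 ∈ levelPositions 1 z.1} := by
    have h1 : MeasurableSet {z : ℝ × ℝ | z.2 ∈ Ioc (-π) π} :=
      measurable_snd measurableSet_Ioc
    have h2 : MeasurableSet {z : ℝ × ℝ | 0 < z.1 + 1 * cos z.2} :=
      measurableSet_lt measurable_const (by fun_prop)
    exact h1.inter h2
  have key : ∀ g : ℝ → ℝ, Measurable g →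
      Measurable fun e => ∫ x in levelPositions 1 e, g x / levelMomentum 1 e x := by
    intro g hg
    have hm : Measurable ({z : ℝ × ℝ | z.2 ∈ levelPositions 1 z.1}.indicator
        fun z => g z.2 / levelMomentum 1 z.1 z.2) := by
      refine Measurable.indicator ?_ hset
      unfold levelMomentum
      fun_prop
    have := hm.stronglyMeasurable.integral_prod_right' (ν := volume)
    convert this.measurable using 2 with e
    have hl : MeasurableSet (levelPositions 1 e) := measurable_prodMk_left (x := e) hset
    rw [← integral_indicator hl]
    rfl
  exact (key _ measurable_cos).div (key _ measurable_const)

/-! ### The averaged cosine at high energy -/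

theorem abs_inv_sqrt_one_add_sub_le {t : ℝ} (ht : |t| ≤ 1 / 2) :
    |1 / √(1 + t) - (1 - t / 2)| ≤ t ^ 2 := by
  have ht' := abs_le.1 ht
  set s := √(1 + t) with hs
  have hsq : s ^ 2 = 1 + t := sq_sqrt (by linarith)
  have hs0 : 0 < s := sqrt_pos.2 (by linarith)
  have e1 : 1 / s - (1 - t / 2) = t ^ 2 * ((s + 2) / (2 * s * (s + 1) ^ 2)) := by
    have : t = s ^ 2 - 1 := by linarith
    rw [this]; field_simp; ring
  rw [e1, abs_of_nonneg (by positivity)]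
  -- The remaining factor is at most 1 because `s² ≥ 1/2`, so that `4 s² ≥ 2`.
  refine mul_le_of_le_one_right (sq_nonneg t) ((div_le_one (by positivity)).2 ?_)
  have : 0 < s ^ 3 := by positivity
  nlinarith

/-- The weight is proportional to `(1 + cos x / e)^(-1/2) = 1 - cos x / (2e) + O(e⁻²)`. The constant
`1 / (4e)` is the one for which `cos x + 1 / (4e)` is orthogonal to the linear part of the weight,
so only the quadratic remainder contributes. -/
theorem abs_reducedAverage_add_le {e : ℝ} (he : 2 ≤ e) :
    |reducedAverage e + 1 / (4 * e)| ≤ 4 / e ^ 2 := by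
  have he0 : 0 < e := by linarith
  have hset : levelPositions 1 e = Ioc (-π) π := by
    ext x
    have := neg_one_le_cos x
    simp only [levelPositions, mem_ofPred_eq, and_iff_left_iff_imp]
    intro _; linarith
  set a := √(2 * e) with ha
  have ha0 : 0 < a := sqrt_pos.2 (by linarith)
  have hpos : ∀ x, 0 < 2 * (e + 1 * cos x) := fun x => by
    have := neg_one_le_cos x; linarith
  have hlm0 : ∀ x, 0 < levelMomentum 1 e x := fun x => sqrt_pos.2 (hpos x)
  have hlm : ∀ x, levelMomentum 1 e x = a * √(1 + cos x / e) := fun x => by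
    rw [levelMomentum, ha, ← sqrt_mul (by linarith)]
    congr 1; field_simp
  have hc : Continuous (levelMomentum 1 e) := by unfold levelMomentum; fun_prop
  have hw : Continuous fun x => 1 / levelMomentum 1 e x :=
    continuous_const.div hc fun x => (hlm0 x).ne'
  have hcw : Continuous fun x => cos x / levelMomentum 1 e x :=
    continuous_cos.div hc fun x => (hlm0 x).ne'
  have hint : ∀ g : ℝ → ℝ, Continuous g → IntegrableOn g (Ioc (-π) π) := fun g hg =>
    (hg.integrableOn_Icc (a := -π) (b := π)).mono_set Ioc_subset_Icc_self
  have hvol : volume.real (Ioc (-π) π) = 2 * π := by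
    rw [volume_real_Ioc_of_le (by linarith [pi_pos])]; ring
  rw [reducedAverage, hset]
  set D := ∫ x in Ioc (-π) π, 1 / levelMomentum 1 e x with hD
  -- A crude lower bound for the normalisation: the momentum is at most `2a`.
  have hDlow : π / a ≤ D := by
    have h1 : ∫ x in Ioc (-π) π, 1 / (2 * a) ≤ D := by
      refine setIntegral_mono (hint _ continuous_const) (hint _ hw) fun x => ?_
      refine one_div_le_one_div_of_le (hlm0 x) ?_
      rw [hlm, mul_comm]
      refine mul_le_mul_of_nonneg_right ?_ ha0.le
      rw [sqrt_le_left (by norm_num)]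
      have : cos x / e ≤ 1 := (div_le_one he0).2 (by linarith [cos_le_one x])
      linarith
    rw [setIntegral_const, hvol] at h1
    refine le_trans (le_of_eq ?_) h1
    simp only [smul_eq_mul]; field_simp
  have hD0 : 0 < D := lt_of_lt_of_le (by positivity) hDlow
  have hzero : ∫ x in Ioc (-π) π, (cos x + 1 / (4 * e)) * (1 - cos x / e / 2) = 0 := by
    rw [← intervalIntegral.integral_of_le (by linarith [pi_pos])]
    have : ∀ x, (cos x + 1 / (4 * e)) * (1 - cos x / e / 2) =
        (1 - 1 / (8 * e ^ 2)) * cos x + (1 / (4 * e) - 1 / (2 * e) * cos x ^ 2) := fun x => by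
      field_simp; ring
    simp only [this]
    rw [intervalIntegral.integral_add (Continuous.intervalIntegrable (by fun_prop) _ _)
      (Continuous.intervalIntegrable (by fun_prop) _ _),
      intervalIntegral.integral_sub (Continuous.intervalIntegrable (by fun_prop) _ _)
      (Continuous.intervalIntegrable (by fun_prop) _ _), intervalIntegral.integral_const_mul,
      intervalIntegral.integral_const_mul, integral_cos, integral_cos_sq,
      intervalIntegral.integral_const]
    simp
    field_simp; ring
  have hN : |(∫ x in Ioc (-π) π, cos x / levelMomentum 1 e x) + D / (4 * e)| ≤
      4 * π / (a * e ^ 2) := by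
    have h1 : (∫ x in Ioc (-π) π, cos x / levelMomentum 1 e x) + D / (4 * e) =
        ∫ x in Ioc (-π) π, 1 / a * ((cos x + 1 / (4 * e)) *
          (1 / √(1 + cos x / e) - (1 - cos x / e / 2))) := by
      have h2 : ∀ x, 1 / a * ((cos x + 1 / (4 * e)) *
          (1 / √(1 + cos x / e) - (1 - cos x / e / 2))) =
          (cos x / levelMomentum 1 e x + (1 / (4 * e)) * (1 / levelMomentum 1 e x)) -
            1 / a * ((cos x + 1 / (4 * e)) * (1 - cos x / e / 2)) := fun x => by
        have h3 := hlm0 x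
        rw [hlm] at h3 ⊢
        have h4 : 0 < √(1 + cos x / e) := pos_of_mul_pos_right h3 ha0.le
        generalize √(1 + cos x / e) = s at h4
        field_simp
      simp only [h2]
      have h5 : IntegrableOn (fun x => cos x / levelMomentum 1 e x +
          (1 / (4 * e)) * (1 / levelMomentum 1 e x)) (Ioc (-π) π) :=
        hint _ (hcw.add (continuous_const.mul hw))
      have h6 : IntegrableOn (fun x => 1 / a * ((cos x + 1 / (4 * e)) * (1 - cos x / e / 2)))
          (Ioc (-π) π) := hint _ (by fun_prop)
      rw [integral_sub h5 h6, integral_add (hint _ hcw) ((hint _ hw).const_mul _), integral_const_mul,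
        integral_const_mul, hzero]
      rw [← hD]; ring
    rw [h1]
    have h2 := norm_setIntegral_le_of_norm_le_const (μ := volume) (s := Ioc (-π) π)
      (f := fun x => 1 / a * ((cos x + 1 / (4 * e)) *
          (1 / √(1 + cos x / e) - (1 - cos x / e / 2)))) (C := 1 / a * (2 * (1 / e ^ 2)))
      (by simp) (fun x _ => ?_)
    · rw [hvol] at h2
      refine h2.trans (le_of_eq ?_)
      field_simp; ring
    · have hcx := abs_cos_le_one x
      have ht : |cos x / e| ≤ 1 / 2 := by
        rw [abs_div, abs_of_pos he0, div_le_div_iff₀ he0 two_pos]; linarith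
      rw [norm_eq_abs, abs_mul, abs_mul, abs_of_pos (by positivity : 0 < 1 / a)]
      refine mul_le_mul_of_nonneg_left (mul_le_mul ?_ ?_ (abs_nonneg _) two_pos.le) (by positivity)
      · have : 1 / (4 * e) ≤ 1 := by rw [div_le_one (by linarith)]; linarith
        refine (abs_add_le _ _).trans ?_
        rw [abs_of_pos (by positivity : 0 < 1 / (4 * e))]; linarith
      · refine (abs_inv_sqrt_one_add_sub_le ht).trans ?_
        rw [div_pow]
        exact div_le_div_of_nonneg_right ((sq_le_one_iff_abs_le_one _).2 hcx) (by positivity)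
  have e2 : (∫ x in Ioc (-π) π, cos x / levelMomentum 1 e x) / D + 1 / (4 * e) =
      ((∫ x in Ioc (-π) π, cos x / levelMomentum 1 e x) + D / (4 * e)) / D := by
    field_simp
  rw [e2, abs_div, abs_of_pos hD0, div_le_iff₀ hD0]
  refine hN.trans ?_
  calc 4 * π / (a * e ^ 2) = 4 / e ^ 2 * (π / a) := by field_simp
    _ ≤ 4 / e ^ 2 * D := mul_le_mul_of_nonneg_left hDlow (by positivity)

theorem abs_cosAverage_le_one {M : ℝ} (hM : 0 < M) (q p : ℝ) : |cosAverage M q p| ≤ 1 := by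
  rw [cosAverage_eq_reducedAverage hM]; exact abs_reducedAverage_le_one _

theorem measurable_cosAverage {M : ℝ} (hM : 0 < M) :
    Measurable fun z : ℝ × ℝ => cosAverage M z.1 z.2 := by
  simp only [cosAverage_eq_reducedAverage hM]
  exact measurable_reducedAverage.comp (by fun_prop)

theorem abs_cosAverage_add_le {M : ℝ} (hM : 0 < M) (q : ℝ) {p : ℝ} (hp : p ≠ 0) :
    |cosAverage M q p + M / (2 * p ^ 2)| ≤ 100 * M ^ 2 / p ^ 4 := by
  rw [cosAverage_eq_reducedAverage hM]
  set v := p ^ 2 / M with hv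
  have hp2 : 0 < p ^ 2 := by positivity
  have hv0 : 0 < v := by positivity
  have e1 : p ^ 2 / (2 * M) = v / 2 := by rw [hv]; field_simp
  have e2 : M / (2 * p ^ 2) = 1 / (2 * v) := by rw [hv]; field_simp
  have e3 : 100 * M ^ 2 / p ^ 4 = 100 / v ^ 2 := by rw [hv]; field_simp
  rw [e1, e2, e3]
  have hc := abs_le.1 (abs_cos_le_one q)
  -- For `v ≤ 6` the trivial bound gives `v² + v / 2 ≤ 39`. For `v ≥ 6` one has `e ≥ 2` and `e ≥ v /
  -- 3`, and replacing `1 / (4e)` by `1 / (2v)` costs `cos q / (2ev)`, for a total of `38 / v²`. The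
  -- constant 100 covers both.
  rcases le_total v 6 with h | h
  · refine (abs_add_le _ _).trans ((add_le_add_left (abs_reducedAverage_le_one _) _).trans ?_)
    rw [abs_of_pos (by positivity), le_div_iff₀ (by positivity)]
    have : (1 + 1 / (2 * v)) * v ^ 2 = v ^ 2 + v / 2 := by field_simp
    rw [this]; nlinarith
  · set e := v / 2 - cos q with he
    have h2 : 2 ≤ e := by linarith
    have h3 : v / 3 ≤ e := by linarith
    have e4 : reducedAverage e + 1 / (2 * v) =
        (reducedAverage e + 1 / (4 * e)) + (-(cos q) / (2 * e * v)) := by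
      have h5 : e ≠ 0 := by linarith
      have : cos q = v / 2 - e := by rw [he]; ring
      rw [this]; field_simp; ring
    have h5 : 4 / e ^ 2 ≤ 36 / v ^ 2 := by
      rw [div_le_div_iff₀ (by positivity) (by positivity)]; nlinarith
    have h6 : |-(cos q) / (2 * e * v)| ≤ 2 / v ^ 2 := by
      rw [abs_div, abs_neg, abs_of_pos (by positivity : 0 < 2 * e * v),
        div_le_div_iff₀ (by positivity) (by positivity)]
      have := abs_cos_le_one q
      calc |cos q| * v ^ 2 ≤ 1 * v ^ 2 := by gcongr
        _ ≤ 2 * (2 * e * v) := by nlinarith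
    rw [e4]
    refine (abs_add_le _ _).trans ((add_le_add ((abs_reducedAverage_add_le h2).trans h5) h6).trans ?_)
    rw [← add_div]
    gcongr; norm_num

/-! ### Taylor estimates in `p` -/

/-- The mean value inequality on `[-|x|, |x|]`. Iterated, it turns a bound on the highest derivative
into a bound on the Taylor remainder with the same constant. -/
theorem abs_le_of_abs_deriv_le_pow {g g' : ℝ → ℝ} (hg : ∀ x, HasDerivAt g (g' x) x)
    (h0 : g 0 = 0) {K R : ℝ} {n : ℕ} (hK : ∀ x, |x| ≤ R → |g' x| ≤ K * |x| ^ n)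
    {x : ℝ} (hx : |x| ≤ R) : |g x| ≤ K * |x| ^ (n + 1) := by
  have hK0 : ∀ y, |y| ≤ |x| → |g' y| ≤ K * |x| ^ n := by
    intro y hy
    refine (hK y (hy.trans hx)).trans ?_
    -- The sign of `K` is not given; it can be read off from the hypothesis only at a point `y ≠ 0`.
    rcases eq_or_ne y 0 with rfl | hy0
    · have := (abs_nonneg _).trans (hK x hx)
      rcases n with _ | n
      · simp
      · simpa using this
    · have h1 := (abs_nonneg _).trans (hK y (hy.trans hx))
      have h2 : 0 ≤ K := nonneg_of_mul_nonneg_left h1 (pow_pos (abs_pos.2 hy0) n)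
      gcongr
  have := (convex_Icc (-|x|) |x|).norm_image_sub_le_of_norm_hasDerivWithin_le (f := g) (f' := g')
    (C := K * |x| ^ n) (fun y _ => (hg y).hasDerivWithinAt) (fun y hy => hK0 y (abs_le.2 hy))
    (x := 0) (y := x) ⟨by simp, by simp⟩ ⟨neg_abs_le x, le_abs_self x⟩
  simpa [h0, pow_succ, mul_assoc] using this

theorem pDeriv_zero (f : ℝ → ℝ → ℝ) (q p : ℝ) : pDeriv 0 f q p = f q p := by
  rw [pDeriv, iteratedDeriv_zero]

namespace AdmissibleInitial

theorem hasDerivAt_pDeriv {f : ℝ → ℝ → ℝ} (hf : AdmissibleInitial f) (n : ℕ) {q : ℝ} (hq : q ∈ Ioc (-π) π) (p : ℝ) :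
    HasDerivAt (pDeriv n f q) (pDeriv (n + 1) f q p) p := by
  have h : Differentiable ℝ (iteratedDeriv n (f q)) :=
    (hf.smooth q hq).differentiable_iteratedDeriv n (by exact_mod_cast WithTop.coe_lt_top _)
  have := (h p).hasDerivAt
  rwa [← iteratedDeriv_succ] at this

theorem pDeriv_odd_zero {f : ℝ → ℝ → ℝ} (hf : AdmissibleInitial f) {n : ℕ} (hn : Odd n) {q : ℝ} (hq : q ∈ Ioc (-π) π) :
    pDeriv n f q 0 = 0 := by
  have h := iteratedDeriv_comp_neg n (f q) 0
  rw [funext (hf.even q hq), hn.neg_one_pow, neg_zero, neg_one_smul] at h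
  rw [pDeriv]; linarith

theorem exists_abs_pDeriv_one_le {f : ℝ → ℝ → ℝ} (hf : AdmissibleInitial f) (R : ℝ) :
    ∃ K, ∀ q ∈ Ioc (-π) π, ∀ p, |p| ≤ R → |pDeriv 1 f q p| ≤ K * |p| := by
  obtain ⟨K, hK⟩ := hf.deriv_bounded 2 (by norm_num) R
  refine ⟨K, fun q hq p hp => ?_⟩
  have := abs_le_of_abs_deriv_le_pow (n := 0) (hf.hasDerivAt_pDeriv 1 hq)
    (hf.pDeriv_odd_zero odd_one hq) (K := K) (fun x hx => by simpa using hK q hq x hx) hp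
  simpa using this

/-- Evenness removes the linear term for `|p| ≤ 1`; for `|p| ≥ 1` boundedness of `f` is enough. The
form of the bound leaves the integrable `(1 + p²)⁻¹` after division by `p²`. -/
theorem exists_abs_sub_le {f : ℝ → ℝ → ℝ} (hf : AdmissibleInitial f) :
    ∃ K, 0 ≤ K ∧ ∀ q ∈ Ioc (-π) π, ∀ p, |f q p - f q 0| ≤ K * p ^ 2 * (1 + p ^ 2)⁻¹ := by
  obtain ⟨K, hK⟩ := hf.exists_abs_pDeriv_one_le 1
  obtain ⟨C, hC⟩ := hf.bounded
  have hq0 : (0 : ℝ) ∈ Ioc (-π) π := ⟨by linarith [pi_pos], pi_pos.le⟩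
  have hC0 : 0 ≤ C := (abs_nonneg _).trans (hC 0 hq0 0)
  have hK0 : 0 ≤ K := by simpa using (abs_nonneg _).trans (hK 0 hq0 1 (by simp))
  refine ⟨2 * K + 4 * C, by positivity, fun q hq p => ?_⟩
  rw [← div_eq_mul_inv, le_div_iff₀ (by positivity)]
  rcases le_total |p| 1 with hp | hp
  · have h1 := abs_le_of_abs_deriv_le_pow (n := 1) (g := fun x => f q x - f q 0)
      (fun x => by simpa [pDeriv_zero] using (hf.hasDerivAt_pDeriv 0 hq x).sub_const (f q 0))
      (by simp) (K := K) (fun x hx => by simpa using hK q hq x hx) hp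
    rw [sq_abs] at h1
    have h2 : p ^ 2 ≤ 1 := (sq_le_one_iff_abs_le_one p).2 hp
    calc |f q p - f q 0| * (1 + p ^ 2) ≤ (K * p ^ 2) * 2 := by gcongr; linarith
      _ ≤ _ := by nlinarith [mul_nonneg hC0 (sq_nonneg p)]
  · have h2 : 1 ≤ p ^ 2 := (one_le_sq_iff_one_le_abs p).2 hp
    have h1 : |f q p - f q 0| ≤ 2 * C := by
      refine (abs_sub _ _).trans ?_
      linarith [hC q hq p, hC q hq 0]
    calc |f q p - f q 0| * (1 + p ^ 2) ≤ (2 * C) * (2 * p ^ 2) := by gcongr; linarith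
      _ ≤ _ := by nlinarith [mul_nonneg hK0 (sq_nonneg p)]

/-- For `|p| ≤ 1`, four integrations starting from the fourth derivative, the odd derivatives
vanishing at 0. For `|p| ≥ 1` the quadratic term dominates, and `p² ≤ 2 p⁴ / (1 + p²)`. -/
theorem exists_abs_sub_taylor_le {f : ℝ → ℝ → ℝ} (hf : AdmissibleInitial f) :
    ∃ K, 0 ≤ K ∧ ∀ q ∈ Ioc (-π) π, ∀ p,
      |f q p - f q 0 - pDeriv 2 f q 0 * p ^ 2 / 2| ≤ K * p ^ 4 * (1 + p ^ 2)⁻¹ := by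
  obtain ⟨K, hK⟩ := hf.deriv_bounded 4 le_rfl 1
  obtain ⟨B, hB⟩ := hf.deriv_bounded 2 (by norm_num) 0
  obtain ⟨C, hC⟩ := hf.bounded
  have hq0 : (0 : ℝ) ∈ Ioc (-π) π := ⟨by linarith [pi_pos], pi_pos.le⟩
  have hC0 : 0 ≤ C := (abs_nonneg _).trans (hC 0 hq0 0)
  have hB0 : 0 ≤ B := (abs_nonneg _).trans (hB 0 hq0 0 (by simp))
  have hK0 : 0 ≤ K := (abs_nonneg _).trans (hK 0 hq0 0 (by simp))
  refine ⟨2 * K + 4 * C + B, by positivity, fun q hq p => ?_⟩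
  rw [← div_eq_mul_inv, le_div_iff₀ (by positivity)]
  rcases le_total |p| 1 with hp | hp
  · have h3 : ∀ x, |x| ≤ 1 → |pDeriv 3 f q x| ≤ K * |x| ^ 1 := fun x hx =>
      abs_le_of_abs_deriv_le_pow (hf.hasDerivAt_pDeriv 3 hq)
        (hf.pDeriv_odd_zero ⟨1, rfl⟩ hq) (fun y hy => by simpa using hK q hq y hy) hx
    have h2 : ∀ x, |x| ≤ 1 → |pDeriv 2 f q x - pDeriv 2 f q 0| ≤ K * |x| ^ 2 := fun x hx =>
      abs_le_of_abs_deriv_le_pow (g := fun x => pDeriv 2 f q x - pDeriv 2 f q 0)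
        (fun y => (hf.hasDerivAt_pDeriv 2 hq y).sub_const _) (sub_self _) h3 hx
    have h1 : ∀ x, |x| ≤ 1 → |pDeriv 1 f q x - pDeriv 2 f q 0 * x| ≤ K * |x| ^ 3 := fun x hx =>
      abs_le_of_abs_deriv_le_pow (g := fun x => pDeriv 1 f q x - pDeriv 2 f q 0 * x)
        (fun y => (hf.hasDerivAt_pDeriv 1 hq y).sub (hasDerivAt_const_mul _))
        (by simp [hf.pDeriv_odd_zero odd_one hq]) h2 hx
    have h0 : |f q p - f q 0 - pDeriv 2 f q 0 * p ^ 2 / 2| ≤ K * |p| ^ 4 :=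
      abs_le_of_abs_deriv_le_pow
        (g := fun x => f q x - f q 0 - pDeriv 2 f q 0 * x ^ 2 / 2)
        (fun y => by
          have h5 := (hf.hasDerivAt_pDeriv 0 hq y).sub_const (f q 0)
          have h6 := ((hasDerivAt_pow 2 y).const_mul (pDeriv 2 f q 0)).div_const 2
          simp only [pDeriv_zero] at h5
          refine (h5.sub h6).congr_deriv ?_
          push_cast; ring)
        (by simp) h1 hp
    have h4 : |p| ^ 4 = p ^ 4 := by rw [show 4 = 2 * 2 from rfl, pow_mul, sq_abs, pow_mul]
    rw [h4] at h0
    have h5 : p ^ 2 ≤ 1 := (sq_le_one_iff_abs_le_one p).2 hp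
    have h6 : 0 ≤ p ^ 4 := by positivity
    calc _ ≤ (K * p ^ 4) * 2 := by gcongr; linarith
      _ ≤ _ := by nlinarith [mul_nonneg hC0 h6, mul_nonneg hB0 h6]
  · have h2 : 1 ≤ p ^ 2 := (one_le_sq_iff_one_le_abs p).2 hp
    have h1 : |f q p - f q 0 - pDeriv 2 f q 0 * p ^ 2 / 2| ≤ (2 * C + B / 2) * p ^ 2 := by
      refine (abs_sub _ _).trans ?_
      have h3 : |f q p - f q 0| ≤ 2 * C * p ^ 2 := by
        refine (abs_sub _ _).trans ?_
        nlinarith [hC q hq p, hC q hq 0]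
      have h4 : |pDeriv 2 f q 0 * p ^ 2 / 2| ≤ B / 2 * p ^ 2 := by
        rw [abs_div, abs_mul, abs_of_pos (by positivity : (0 : ℝ) < 2),
          abs_of_nonneg (sq_nonneg p)]
        have := hB q hq 0 (by simp)
        nlinarith
      linarith
    have h6 : 0 ≤ p ^ 4 := by positivity
    calc _ ≤ (2 * C + B / 2) * p ^ 2 * (2 * p ^ 2) := by gcongr; linarith
      _ ≤ _ := by nlinarith [mul_nonneg hK0 h6]

/-- Each derivative is a pointwise limit of difference quotients with steps `1 / (m + 1)`.
Smoothness is known only for `q` in the strip, whence the indicator and the auxiliary function `G`.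
-/
theorem exists_measurable_pDeriv {f : ℝ → ℝ → ℝ} (hf : AdmissibleInitial f) (n : ℕ) :
    ∃ G : ℝ × ℝ → ℝ, Measurable G ∧ ∀ q ∈ Ioc (-π) π, ∀ p, G (q, p) = pDeriv n f q p := by
  induction n with
  | zero => exact ⟨_, hf.measurable, fun q _ p => (pDeriv_zero f q p).symm⟩
  | succ n ih =>
    obtain ⟨G, hG, hGf⟩ := ih
    set S : Set (ℝ × ℝ) := Prod.fst ⁻¹' Ioc (-π) π with hS
    have hSm : MeasurableSet S := measurable_fst measurableSet_Ioc
    set u : ℕ → ℝ × ℝ → ℝ := fun m => S.indicator fun z =>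
      (1 / ((m : ℝ) + 1))⁻¹ * (G (z.1, z.2 + 1 / ((m : ℝ) + 1)) - G z) with hu
    refine ⟨S.indicator fun z => pDeriv (n + 1) f z.1 z.2, ?_, fun q hq p =>
      indicator_of_mem (show (q, p) ∈ S from hq) _⟩
    refine measurable_of_tendsto_metrizable (f := u) (fun m => ?_) (tendsto_pi_nhds.2 ?_)
    · exact Measurable.indicator (by fun_prop) hSm
    · rintro ⟨q, p⟩
      by_cases hq : q ∈ Ioc (-π) π
      · have hmem : (q, p) ∈ S := hq
        simp only [hu, indicator_of_mem hmem, hGf q hq]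
        have h1 := (hasDerivAt_iff_tendsto_slope_zero.1 (hf.hasDerivAt_pDeriv n hq p))
        have h2 : Tendsto (fun m : ℕ => 1 / ((m : ℝ) + 1)) atTop (𝓝[≠] 0) :=
          tendsto_nhdsWithin_iff.2 ⟨tendsto_one_div_add_atTop_nhds_zero_nat,
            Eventually.of_forall fun m => (by positivity : 1 / ((m : ℝ) + 1) ≠ 0)⟩
        exact h1.comp h2
      · have hmem : (q, p) ∉ S := hq
        simp only [hu, indicator_of_notMem hmem]
        exact tendsto_const_nhds

end AdmissibleInitial

/-! ### Integration over the phase space with majorant `(1 + p²)⁻¹` -/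

theorem restrict_phaseSpace :
    (volume : Measure (ℝ × ℝ)).restrict phaseSpace =
      ((volume : Measure ℝ).restrict (Ioc (-π) π)).prod volume := by
  rw [phaseSpace, Measure.volume_eq_prod, ← Measure.prod_restrict, Measure.restrict_univ]

theorem measurableSet_phaseSpace : MeasurableSet phaseSpace :=
  measurableSet_Ioc.prod MeasurableSet.univ

theorem ae_phaseSpace :
    ∀ᵐ z ∂(volume : Measure (ℝ × ℝ)).restrict phaseSpace, z.1 ∈ Ioc (-π) π ∧ z.2 ≠ 0 := by
  refine Eventually.and ?_ ?_
  · filter_upwards [ae_restrict_mem measurableSet_phaseSpace] with z hz using hz.1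
  · rw [restrict_phaseSpace]
    exact Measure.quasiMeasurePreserving_snd.ae (Measure.ae_ne volume 0)

theorem integrableOn_phaseSpace_inv_one_add_sq :
    IntegrableOn (fun z : ℝ × ℝ => (1 + z.2 ^ 2)⁻¹) phaseSpace := by
  rw [IntegrableOn, restrict_phaseSpace]
  simpa using Integrable.mul_prod (μ := volume.restrict (Ioc (-π) π))
    (integrable_const (1 : ℝ)) integrable_inv_one_add_sq

theorem integrableOn_phaseSpace_of_abs_le {F : ℝ × ℝ → ℝ} {K : ℝ}
    (hF : AEStronglyMeasurable F (volume.restrict phaseSpace))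
    (hK : ∀ q ∈ Ioc (-π) π, ∀ p ≠ 0, |F (q, p)| ≤ K * (1 + p ^ 2)⁻¹) :
    IntegrableOn F phaseSpace := by
  refine Integrable.mono' (integrableOn_phaseSpace_inv_one_add_sq.const_mul K) hF ?_
  filter_upwards [ae_phaseSpace] with z hz using hK z.1 hz.1 z.2 hz.2

theorem abs_integral_phaseSpace_le {F : ℝ × ℝ → ℝ} {K : ℝ}
    (hK : ∀ q ∈ Ioc (-π) π, ∀ p ≠ 0, |F (q, p)| ≤ K * (1 + p ^ 2)⁻¹) :
    |∫ z in phaseSpace, F z| ≤ K * ∫ z in phaseSpace, (1 + z.2 ^ 2)⁻¹ := by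
  rw [← integral_const_mul K]
  refine norm_integral_le_of_norm_le (f := F) (integrableOn_phaseSpace_inv_one_add_sq.const_mul K) ?_
  filter_upwards [ae_phaseSpace] with z hz using hK z.1 hz.1 z.2 hz.2

theorem tendsto_integral_truncated {F : ℝ × ℝ → ℝ} (hF : IntegrableOn F phaseSpace) :
    Tendsto (fun R : ℝ => ∫ z in Ioc (-π) π ×ˢ Ioo (-R) R, F z) atTop
      (𝓝 (∫ z in phaseSpace, F z)) := by
  have hU : ⋃ R : ℝ, Ioc (-π) π ×ˢ Ioo (-R) R = phaseSpace := by
    rw [← Set.prod_iUnion, phaseSpace]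
    congr 1
    refine eq_univ_of_forall fun x => mem_iUnion.2 ⟨|x| + 1, ?_, ?_⟩
    · linarith [neg_abs_le x]
    · linarith [le_abs_self x]
  have := tendsto_setIntegral_of_monotone (μ := volume) (f := F)
    (s := fun R : ℝ => Ioc (-π) π ×ˢ Ioo (-R) R)
    (fun R => measurableSet_Ioc.prod measurableSet_Ioo)
    (fun R S h => Set.prod_mono_right (Ioo_subset_Ioo (neg_le_neg h) h)) (by rwa [hU])
  rwa [hU] at this

theorem coeffOne_eq_of_integrableOn {f : ℝ → ℝ → ℝ}
    (h : IntegrableOn (fun z : ℝ × ℝ => pDeriv 1 f z.1 z.2 / z.2) phaseSpace) :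
    coeffOne f = -(1 / 2) * ∫ z in phaseSpace, pDeriv 1 f z.1 z.2 / z.2 :=
  ((tendsto_integral_truncated h).const_mul (-(1 / 2))).limUnder_eq

theorem abs_cosAverage_le {M : ℝ} (hM : 0 < M) (q : ℝ) {p : ℝ} (hp : p ≠ 0) :
    |cosAverage M q p| ≤ (2 + M + 200 * M ^ 2) * (1 + p ^ 2)⁻¹ := by
  have h1 := abs_cosAverage_le_one hM q p
  have hp2 : 0 < p ^ 2 := by positivity
  rw [← div_eq_mul_inv, le_div_iff₀ (by positivity)]
  rcases le_total (p ^ 2) 1 with h | h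
  · calc |cosAverage M q p| * (1 + p ^ 2) ≤ 1 * 2 := by gcongr; linarith
      _ ≤ _ := by nlinarith
  · have h2 := abs_cosAverage_add_le hM q hp
    have h3 : |cosAverage M q p| ≤ (M / 2 + 100 * M ^ 2) / p ^ 2 := by
      have e : cosAverage M q p = (cosAverage M q p + M / (2 * p ^ 2)) - M / (2 * p ^ 2) := by ring
      rw [e]
      refine (abs_sub _ _).trans ?_
      rw [abs_of_pos (by positivity : 0 < M / (2 * p ^ 2)), add_comm (M / 2), add_div]
      refine add_le_add (h2.trans ?_) (le_of_eq (by field_simp))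
      rw [show p ^ 4 = p ^ 2 * p ^ 2 by ring]
      exact div_le_div_of_nonneg_left (by positivity) hp2 (by nlinarith)
    calc |cosAverage M q p| * (1 + p ^ 2) ≤ (M / 2 + 100 * M ^ 2) / p ^ 2 * (2 * p ^ 2) := by
          gcongr; linarith
      _ = M + 200 * M ^ 2 := by field_simp; ring
      _ ≤ _ := by linarith

/-- As `|p| → ∞`, `p² C / 2` tends to `-M / 4`; the added `M / 4` is what makes the expression
integrable. -/
theorem abs_sq_mul_cosAverage_add_le {M : ℝ} (hM : 0 < M) (q : ℝ) {p : ℝ} (hp : p ≠ 0) :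
    |p ^ 2 / 2 * cosAverage M q p + M / 4| ≤ (1 + M + 100 * M ^ 2) * (1 + p ^ 2)⁻¹ := by
  have hp2 : 0 < p ^ 2 := by positivity
  rw [← div_eq_mul_inv, le_div_iff₀ (by positivity)]
  rcases le_total (p ^ 2) 1 with h | h
  · have h2 : |p ^ 2 / 2 * cosAverage M q p + M / 4| ≤ 1 / 2 + M / 4 := by
      refine (abs_add_le _ _).trans ?_
      rw [abs_mul, abs_of_pos (by positivity : 0 < p ^ 2 / 2),
        abs_of_pos (by positivity : 0 < M / 4)]
      nlinarith [abs_cosAverage_le_one hM q p]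
    calc _ ≤ (1 / 2 + M / 4) * 2 := by gcongr; linarith
      _ ≤ _ := by nlinarith
  · have h2 := abs_cosAverage_add_le hM q hp
    have e : p ^ 2 / 2 * cosAverage M q p + M / 4 =
        p ^ 2 / 2 * (cosAverage M q p + M / (2 * p ^ 2)) := by field_simp; ring
    rw [e, abs_mul, abs_of_pos (by positivity : 0 < p ^ 2 / 2)]
    calc _ ≤ p ^ 2 / 2 * (100 * M ^ 2 / p ^ 4) * (2 * p ^ 2) := by gcongr; linarith
      _ = 100 * M ^ 2 := by field_simp
      _ ≤ _ := by nlinarith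

/-! ### Integrability, and the coefficient `L₁` -/

namespace AdmissibleInitial

theorem aestronglyMeasurable_pDeriv {f : ℝ → ℝ → ℝ} (hf : AdmissibleInitial f) (n : ℕ) :
    AEStronglyMeasurable (fun z : ℝ × ℝ => pDeriv n f z.1 z.2) (volume.restrict phaseSpace) := by
  obtain ⟨G, hG, h⟩ := hf.exists_measurable_pDeriv n
  refine hG.aestronglyMeasurable.congr ?_
  filter_upwards [ae_phaseSpace] with z hz using h z.1 hz.1 z.2

theorem aestronglyMeasurable_pDeriv_zero {f : ℝ → ℝ → ℝ} (hf : AdmissibleInitial f) (n : ℕ) :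
    AEStronglyMeasurable (fun z : ℝ × ℝ => pDeriv n f z.1 0) (volume.restrict phaseSpace) := by
  obtain ⟨G, hG, h⟩ := hf.exists_measurable_pDeriv n
  have h1 : Measurable fun z : ℝ × ℝ => G (z.1, 0) := by fun_prop
  refine h1.aestronglyMeasurable.congr ?_
  filter_upwards [ae_phaseSpace] with z hz using h z.1 hz.1 0

theorem integrableOn_cosAverage_mul {f : ℝ → ℝ → ℝ} (hf : AdmissibleInitial f) {M : ℝ}
    (hM : 0 < M) : IntegrableOn (fun z : ℝ × ℝ => cosAverage M z.1 z.2 * f z.1 z.2) phaseSpace := by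
  obtain ⟨C, hC⟩ := hf.bounded
  refine integrableOn_phaseSpace_of_abs_le (K := (2 + M + 200 * M ^ 2) * C)
    ((measurable_cosAverage hM).mul hf.measurable).aestronglyMeasurable fun q hq p hp => ?_
  rw [abs_mul, mul_right_comm]
  exact mul_le_mul (abs_cosAverage_le hM q hp) (hC q hq p) (abs_nonneg _) (by positivity)

theorem integrableOn_zero_mul_cosAverage {f : ℝ → ℝ → ℝ} (hf : AdmissibleInitial f) {M : ℝ}
    (hM : 0 < M) : IntegrableOn (fun z : ℝ × ℝ => f z.1 0 * cosAverage M z.1 z.2) phaseSpace := by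
  obtain ⟨C, hC⟩ := hf.bounded
  have h0 : Measurable fun z : ℝ × ℝ => f z.1 0 :=
    hf.measurable.comp (by fun_prop : Measurable fun z : ℝ × ℝ => (z.1, (0 : ℝ)))
  refine integrableOn_phaseSpace_of_abs_le (K := C * (2 + M + 200 * M ^ 2))
    (h0.mul (measurable_cosAverage hM)).aestronglyMeasurable fun q hq p hp => ?_
  rw [abs_mul, mul_assoc]
  exact mul_le_mul (hC q hq 0) (abs_cosAverage_le hM q hp) (abs_nonneg _)
    ((abs_nonneg _).trans (hC q hq 0))

theorem integrableOn_pDeriv_two_mul {f : ℝ → ℝ → ℝ} (hf : AdmissibleInitial f) {M : ℝ}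
    (hM : 0 < M) : IntegrableOn (fun z : ℝ × ℝ =>
      pDeriv 2 f z.1 0 * (z.2 ^ 2 / 2 * cosAverage M z.1 z.2 + M / 4)) phaseSpace := by
  obtain ⟨C, hC⟩ := hf.deriv_bounded 2 (by norm_num) 0
  have h1 : Measurable fun z : ℝ × ℝ => z.2 ^ 2 / 2 * cosAverage M z.1 z.2 + M / 4 :=
    (Measurable.mul (by fun_prop) (measurable_cosAverage hM)).add_const _
  refine integrableOn_phaseSpace_of_abs_le (K := C * (1 + M + 100 * M ^ 2))
    ((hf.aestronglyMeasurable_pDeriv_zero 2).mul h1.aestronglyMeasurable) fun q hq p hp => ?_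
  have := hC q hq 0 (by simp)
  rw [abs_mul, mul_assoc]
  exact mul_le_mul this (abs_sq_mul_cosAverage_add_le hM q hp) (abs_nonneg _)
    ((abs_nonneg _).trans this)

theorem integrableOn_sub_div_sq {f : ℝ → ℝ → ℝ} (hf : AdmissibleInitial f) :
    IntegrableOn (fun z : ℝ × ℝ => (f z.1 z.2 - f z.1 0) / z.2 ^ 2) phaseSpace := by
  obtain ⟨K, _, hK⟩ := hf.exists_abs_sub_le
  have h0 : Measurable fun z : ℝ × ℝ => f z.1 0 :=
    hf.measurable.comp (by fun_prop : Measurable fun z : ℝ × ℝ => (z.1, (0 : ℝ)))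
  refine integrableOn_phaseSpace_of_abs_le (K := K)
    ((hf.measurable.sub h0).div (by fun_prop)).aestronglyMeasurable fun q hq p hp => ?_
  have hp2 : 0 < p ^ 2 := by positivity
  rw [abs_div, abs_of_pos hp2, div_le_iff₀ hp2]
  exact (hK q hq p).trans (le_of_eq (by ring))

theorem integrableOn_pDeriv_one_div {f : ℝ → ℝ → ℝ} (hf : AdmissibleInitial f) (R : ℝ) :
    IntegrableOn (fun z : ℝ × ℝ => pDeriv 1 f z.1 z.2 / z.2) (Ioc (-π) π ×ˢ Ioo (-R) R) := by
  obtain ⟨K, hK⟩ := hf.exists_abs_pDeriv_one_le R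
  have hfin : IsFiniteMeasure ((volume : Measure (ℝ × ℝ)).restrict
      (Ioc (-π) π ×ˢ Ioo (-R) R)) := by
    rw [isFiniteMeasure_restrict, Measure.volume_eq_prod, Measure.prod_prod]
    exact ENNReal.mul_ne_top measure_Ioc_lt_top.ne measure_Ioo_lt_top.ne
  refine Integrable.of_bound ?_ |K| ?_
  · have h : AEStronglyMeasurable (fun z : ℝ × ℝ => pDeriv 1 f z.1 z.2 * z.2⁻¹)
        (volume.restrict phaseSpace) :=
      (hf.aestronglyMeasurable_pDeriv 1).mul measurable_snd.inv.aestronglyMeasurable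
    exact h.mono_set (Set.prod_mono_right (subset_univ _))
  · filter_upwards [ae_restrict_mem (measurableSet_Ioc.prod measurableSet_Ioo)] with z hz
    have h1 := hK z.1 hz.1 z.2 (abs_le.2 ⟨hz.2.1.le, hz.2.2.le⟩)
    rw [norm_eq_abs, abs_div]
    refine div_le_of_le_mul₀ (abs_nonneg _) (abs_nonneg _) (h1.trans ?_)
    gcongr
    exact le_abs_self K

/-- Integration by parts: `(f - f₀) / p` has derivative `f⁽¹⁾ / p - (f - f₀) / p²` away from 0. By
evenness the boundary terms at `R` and `-R` add up. -/
theorem integral_pDeriv_one_div {f : ℝ → ℝ → ℝ} (hf : AdmissibleInitial f) {q : ℝ}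
    (hq : q ∈ Ioc (-π) π) {R : ℝ} (hR : 0 < R) :
    ∫ p in Ioo (-R) R, pDeriv 1 f q p / p =
      2 * (f q R - f q 0) / R + ∫ p in Ioo (-R) R, (f q p - f q 0) / p ^ 2 := by
  have hd : ∀ p, HasDerivAt (f q) (pDeriv 1 f q p) p := fun p => by
    have := hf.hasDerivAt_pDeriv 0 hq p
    rwa [show pDeriv 0 f q = f q from funext (pDeriv_zero f q)] at this
  have hint : ∀ F : ℝ → ℝ, Measurable F → ∀ K, (∀ p, |p| ≤ R → |F p| ≤ K) →
      IntervalIntegrable F volume (-R) R := by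
    intro F hF K hK
    rw [intervalIntegrable_iff_integrableOn_Ioc_of_le (by linarith)]
    refine Measure.integrableOn_of_bounded (M := K) measure_Ioc_lt_top.ne
      hF.aestronglyMeasurable ?_
    filter_upwards [ae_restrict_mem measurableSet_Ioc] with p hp
    exact hK p (abs_le.2 ⟨hp.1.le, hp.2⟩)
  obtain ⟨K, hK⟩ := hf.exists_abs_pDeriv_one_le R
  have hm1 : Continuous (pDeriv 1 f q) :=
    continuous_iff_continuousAt.2 fun p => (hf.hasDerivAt_pDeriv 1 hq p).continuousAt
  have hm0 : Continuous (f q) := continuous_iff_continuousAt.2 fun p => (hd p).continuousAt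
  have hi1 : IntervalIntegrable (fun p => pDeriv 1 f q p / p) volume (-R) R := by
    refine hint _ (hm1.measurable.div measurable_id) |K| fun p hp => ?_
    rw [abs_div]
    refine div_le_of_le_mul₀ (abs_nonneg _) (abs_nonneg _) ((hK q hq p hp).trans ?_)
    gcongr
    exact le_abs_self K
  obtain ⟨K', hK'0, hK'⟩ := hf.exists_abs_sub_le
  have hi2 : IntervalIntegrable (fun p => (f q p - f q 0) / p ^ 2) volume (-R) R := by
    refine hint _ ((hm0.measurable.sub_const _).div (by fun_prop)) K' fun p _ => ?_
    rw [abs_div, abs_of_nonneg (sq_nonneg p)]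
    refine div_le_of_le_mul₀ (sq_nonneg p) hK'0 ((hK' q hq p).trans ?_)
    exact mul_le_of_le_one_right (by positivity) (inv_le_one_of_one_le₀ (by nlinarith [sq_nonneg p]))
  -- `dslope` fills in the difference quotient continuously at 0, so the fundamental theorem of
  -- calculus applies with the single exceptional point 0.
  have hcont : Continuous (dslope (f q) 0) := by
    refine continuous_iff_continuousAt.2 fun p => ?_
    rcases eq_or_ne p 0 with rfl | hp
    · exact continuousAt_dslope_same.2 (hd 0).differentiableAt
    · exact (continuousAt_dslope_of_ne hp).2 hm0.continuousAt
  have key := integral_eq_of_hasDerivAt_off_countable (a := -R) (b := R) (dslope (f q) 0)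
    (fun p => pDeriv 1 f q p / p - (f q p - f q 0) / p ^ 2) (countable_singleton 0)
    hcont.continuousOn (fun p hp => ?_) (hi1.sub hi2)
  · rw [intervalIntegral.integral_sub hi1 hi2, intervalIntegral.integral_of_le (by linarith),
      intervalIntegral.integral_of_le (by linarith), integral_Ioc_eq_integral_Ioo,
      integral_Ioc_eq_integral_Ioo, dslope_of_ne _ hR.ne', dslope_of_ne _ (neg_ne_zero.2 hR.ne'),
      slope_def_field, slope_def_field, hf.even q hq] at key
    rw [sub_eq_iff_eq_add.1 key]
    rw [sub_zero, sub_zero]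
    congr 1
    field_simp; ring
  · have hp0 : p ≠ 0 := hp.2
    have h1 : HasDerivAt (fun x => (f q x - f q 0) / x)
        (pDeriv 1 f q p / p - (f q p - f q 0) / p ^ 2) p :=
      (((hd p).sub_const (f q 0)).div (hasDerivAt_id p) hp0).congr_deriv (by
        simp only [id]; field_simp)
    refine h1.congr_of_eventuallyEq ?_
    filter_upwards [isOpen_ne.mem_nhds hp0] with x hx
    rw [dslope_of_ne _ hx, slope_def_field, sub_zero]

/-- The boundary term is `O(1 / R)` since `f` is bounded, and `(f - f₀) / p²` is absolutely
integrable. This gives the improper integral a value without integrability of `f⁽¹⁾ / p` at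
infinity. -/
theorem tendsto_coeffOneTruncated {f : ℝ → ℝ → ℝ} (hf : AdmissibleInitial f) :
    Tendsto (coeffOneTruncated f) atTop
      (𝓝 (-(1 / 2) * ∫ z in phaseSpace, (f z.1 z.2 - f z.1 0) / z.2 ^ 2)) := by
  obtain ⟨C, hC⟩ := hf.bounded
  have hbdry : Tendsto (fun R : ℝ => ∫ q in Ioc (-π) π, 2 * (f q R - f q 0) / R) atTop (𝓝 0) := by
    refine squeeze_zero_norm' (a := fun R : ℝ => 4 * C * (2 * π) / R) ?_
      (tendsto_const_nhds.div_atTop tendsto_id)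
    filter_upwards [eventually_gt_atTop 0] with R hR
    refine (norm_setIntegral_le_of_norm_le_const (C := 4 * C / R) measure_Ioc_lt_top
      fun q hq => ?_).trans (le_of_eq ?_)
    · rw [norm_eq_abs, abs_div, abs_mul, abs_of_pos hR, abs_two]
      refine div_le_div_of_nonneg_right ?_ hR.le
      have := abs_sub (f q R) (f q 0)
      linarith [hC q hq R, hC q hq 0]
    · rw [volume_real_Ioc_of_le (by linarith [pi_pos])]; ring
  have h := (hbdry.add (tendsto_integral_truncated hf.integrableOn_sub_div_sq)).const_mul (-(1 / 2))
  rw [zero_add] at h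
  refine h.congr' ?_
  filter_upwards [eventually_gt_atTop 0] with R hR
  have hi := hf.integrableOn_sub_div_sq.mono_set
    (Set.prod_mono_right (s := Ioc (-π) π) (subset_univ (Ioo (-R) R)))
  have h0 : Measurable fun q => f q 0 :=
    hf.measurable.comp (by fun_prop : Measurable fun q : ℝ => (q, (0 : ℝ)))
  have hR' : Measurable fun q => f q R :=
    hf.measurable.comp (by fun_prop : Measurable fun q : ℝ => (q, R))
  rw [coeffOneTruncated, Measure.volume_eq_prod, setIntegral_prod _ (hf.integrableOn_pDeriv_one_div R),
    setIntegral_prod _ hi, setIntegral_congr_fun measurableSet_Ioc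
      (fun q hq => hf.integral_pDeriv_one_div hq hR), integral_add]
  · refine Measure.integrableOn_of_bounded (M := 4 * C / R) measure_Ioc_lt_top.ne
      (((hR'.sub h0).const_mul 2).div_const R).aestronglyMeasurable ?_
    filter_upwards [ae_restrict_mem measurableSet_Ioc] with q hq
    rw [norm_eq_abs, abs_div, abs_mul, abs_of_pos hR, abs_two]
    refine div_le_div_of_nonneg_right ?_ hR.le
    have := abs_sub (f q R) (f q 0)
    linarith [hC q hq R, hC q hq 0]
  · rw [IntegrableOn, Measure.volume_eq_prod, ← Measure.prod_restrict] at hi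
    exact hi.integral_prod_left

theorem coeffOne_eq {f : ℝ → ℝ → ℝ} (hf : AdmissibleInitial f) :
    coeffOne f = -(1 / 2) * ∫ z in phaseSpace, (f z.1 z.2 - f z.1 0) / z.2 ^ 2 :=
  hf.tendsto_coeffOneTruncated.limUnder_eq

/-! ### The remainder of the expansion -/

theorem magnetizationIntegral_sub_expansion {f : ℝ → ℝ → ℝ} (hf : AdmissibleInitial f) {M : ℝ}
    (hM : 0 < M) : magnetizationIntegral f M - expansion f M =
      ∫ z in phaseSpace, (cosAverage M z.1 z.2 + M / (2 * z.2 ^ 2)) *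
        (f z.1 z.2 - f z.1 0 - pDeriv 2 f z.1 0 * z.2 ^ 2 / 2) := by
  have e1 : ∀ r I : ℝ, M ^ (-r) * I * M ^ r = I := fun r I => by
    rw [mul_right_comm, ← rpow_add hM, neg_add_cancel, rpow_zero, one_mul]
  rw [expansion, coeffHalf, coeffThreeHalves, e1, e1, hf.coeffOne_eq, magnetizationIntegral]
  have i1 := hf.integrableOn_cosAverage_mul hM
  have i2 := hf.integrableOn_zero_mul_cosAverage hM
  have i3 := hf.integrableOn_pDeriv_two_mul hM
  have i4 := hf.integrableOn_sub_div_sq.const_mul (M / 2)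
  have e2 : ∫ z in phaseSpace, (cosAverage M z.1 z.2 + M / (2 * z.2 ^ 2)) *
        (f z.1 z.2 - f z.1 0 - pDeriv 2 f z.1 0 * z.2 ^ 2 / 2) =
      ∫ z in phaseSpace, (cosAverage M z.1 z.2 * f z.1 z.2 -
        (f z.1 0 * cosAverage M z.1 z.2 +
          pDeriv 2 f z.1 0 * (z.2 ^ 2 / 2 * cosAverage M z.1 z.2 + M / 4)) +
        M / 2 * ((f z.1 z.2 - f z.1 0) / z.2 ^ 2)) := by
    refine integral_congr_ae ?_
    filter_upwards [ae_phaseSpace] with z hz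
    have := hz.2
    field_simp; ring
  have h1 := integral_add (i1.sub (i2.add i3)) i4
  have h2 := integral_sub i1 (i2.add i3)
  have h3 := integral_add i2 i3
  simp only [Pi.add_apply, Pi.sub_apply] at h1 h2 h3
  rw [e2, h1, h2, h3, integral_const_mul]
  ring

theorem exists_abs_magnetizationIntegral_sub_expansion_le {f : ℝ → ℝ → ℝ}
    (hf : AdmissibleInitial f) :
    ∃ K, 0 ≤ K ∧ ∀ M, 0 < M → |magnetizationIntegral f M - expansion f M| ≤ K * M ^ 2 := by
  obtain ⟨K, hK0, hK⟩ := hf.exists_abs_sub_taylor_le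
  refine ⟨100 * K * ∫ z in phaseSpace, (1 + z.2 ^ 2)⁻¹,
    mul_nonneg (by positivity) (integral_nonneg fun z => by positivity), fun M hM => ?_⟩
  rw [hf.magnetizationIntegral_sub_expansion hM]
  refine (abs_integral_phaseSpace_le (K := 100 * K * M ^ 2) fun q hq p hp => ?_).trans
    (le_of_eq (by ring))
  rw [abs_mul]
  refine (mul_le_mul (abs_cosAverage_add_le hM q hp) (hK q hq p) (abs_nonneg _)
    (by positivity)).trans (le_of_eq ?_)
  field_simp

theorem exists_abs_magnetizationIntegral_sub_expansion_le_rpow {f : ℝ → ℝ → ℝ}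
    (hf : AdmissibleInitial f) :
    ∃ K, ∀ M, 0 < M → M < 1 →
      |magnetizationIntegral f M - expansion f M| ≤ K * M ^ (7 / 4 : ℝ) := by
  obtain ⟨K, hK0, hK⟩ := hf.exists_abs_magnetizationIntegral_sub_expansion_le
  refine ⟨K, fun M hM hM1 => (hK M hM).trans (mul_le_mul_of_nonneg_left ?_ hK0)⟩
  rw [← rpow_natCast]
  exact rpow_le_rpow_of_exponent_ge hM hM1.le (by norm_num)

end AdmissibleInitial

/-! ### From the momentum to the modulus -/

theorem image_mul_sqrt_sq_sub_sq {c s : ℝ} (hc : 0 < c) (hs : 0 ≤ s) :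
    (fun k => c * √(k ^ 2 - s ^ 2)) '' Ioi s = Ioi 0 := by
  ext p
  constructor
  · rintro ⟨k, hk, rfl⟩
    have hk : s < k := hk
    exact mul_pos hc (sqrt_pos.2 (by nlinarith))
  · intro hp
    have hp : 0 < p := hp
    have h1 : 0 < (p / c) ^ 2 := by positivity
    refine ⟨√((p / c) ^ 2 + s ^ 2), ?_, ?_⟩
    · exact (lt_sqrt hs).2 (by linarith)
    · have h2 : √((p / c) ^ 2 + s ^ 2) ^ 2 - s ^ 2 = (p / c) ^ 2 := by
        rw [sq_sqrt (by positivity)]; ring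
      simp only [h2]
      rw [sqrt_sq (by positivity)]
      field_simp

theorem injOn_mul_sqrt_sq_sub_sq {c s : ℝ} (hc : 0 < c) (hs : 0 ≤ s) :
    InjOn (fun k => c * √(k ^ 2 - s ^ 2)) (Ioi s) := by
  intro k hk l hl h
  have hk : s < k := hk
  have hl : s < l := hl
  have h1 := mul_left_cancel₀ hc.ne' h
  rw [sqrt_inj (by nlinarith) (by nlinarith)] at h1
  exact (sq_eq_sq₀ (by linarith) (by linarith)).1 (by linarith)

theorem hasDerivAt_mul_sqrt_sq_sub_sq (c : ℝ) {s k : ℝ} (hs : 0 ≤ s) (hk : s < k) :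
    HasDerivAt (fun k => c * √(k ^ 2 - s ^ 2)) (c / √(1 - s ^ 2 / k ^ 2)) k := by
  have h0 : 0 < k ^ 2 - s ^ 2 := by nlinarith
  have hk0 : 0 < k := by linarith
  have h1 := ((((hasDerivAt_pow 2 k).sub_const (s ^ 2))).sqrt h0.ne').const_mul c
  refine h1.congr_deriv ?_
  have h2 : 1 - s ^ 2 / k ^ 2 = (k ^ 2 - s ^ 2) / k ^ 2 := by field_simp
  have h3 := sqrt_pos.2 h0
  rw [h2, sqrt_div h0.le, sqrt_sq hk0.le]
  push_cast
  field_simp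

/-- Used with `c = 2√M` and `s = |sin (q / 2)|`: at fixed `q`, `p = c √(k² - s²)` is the positive
momentum of modulus `k`, and `c / √(1 - s² / k²)` is `dp / dk`. -/
theorem integral_Ioi_zero_eq_integral_modulus {c s : ℝ} (hc : 0 < c) (hs : 0 ≤ s) (g : ℝ → ℝ) :
    ∫ p in Ioi 0, g p =
      ∫ k in Ioi s, c / √(1 - s ^ 2 / k ^ 2) * g (c * √(k ^ 2 - s ^ 2)) := by
  rw [← image_mul_sqrt_sq_sub_sq hc hs, integral_image_eq_integral_abs_deriv_smul
    measurableSet_Ioi (fun k hk => (hasDerivAt_mul_sqrt_sq_sub_sq c hs hk).hasDerivWithinAt)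
    (injOn_mul_sqrt_sq_sub_sq hc hs)]
  refine setIntegral_congr_fun measurableSet_Ioi fun k _ => ?_
  simp only [smul_eq_mul]
  rw [abs_of_nonneg (by positivity)]

theorem integrableOn_Ioi_zero_iff_modulus {c s : ℝ} (hc : 0 < c) (hs : 0 ≤ s) (g : ℝ → ℝ) :
    IntegrableOn g (Ioi 0) ↔
      IntegrableOn (fun k => c / √(1 - s ^ 2 / k ^ 2) * g (c * √(k ^ 2 - s ^ 2))) (Ioi s) := by
  rw [← image_mul_sqrt_sq_sub_sq hc hs, integrableOn_image_iff_integrableOn_abs_deriv_smul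
    measurableSet_Ioi (fun k hk => (hasDerivAt_mul_sqrt_sq_sub_sq c hs hk).hasDerivWithinAt)
    (injOn_mul_sqrt_sq_sub_sq hc hs)]
  refine integrableOn_congr_fun (fun k _ => ?_) measurableSet_Ioi
  simp only [smul_eq_mul]
  rw [abs_of_nonneg (by positivity)]

theorem abs_sin_half_lt_iff {k q : ℝ} (hk : k ∈ Ioo (0 : ℝ) 1) (hq : q ∈ Ioc (-π) π) :
    |sin (q / 2)| < k ↔ q ∈ Ioo (-(2 * arcsin k)) (2 * arcsin k) := by
  have hk1 : k ∈ Icc (-1 : ℝ) 1 := ⟨by linarith [hk.1], hk.2.le⟩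
  have hk2 : -k ∈ Icc (-1 : ℝ) 1 := ⟨by linarith [hk.2], by linarith [hk.1]⟩
  have hq1 : q / 2 ∈ Icc (-(π / 2)) (π / 2) := ⟨by linarith [hq.1], by linarith [hq.2]⟩
  rw [abs_lt, ← lt_arcsin_iff_sin_lt hq1 hk1, ← arcsin_lt_iff_lt_sin hk2 hq1, arcsin_neg]
  constructor <;> rintro ⟨h1, h2⟩ <;> constructor <;> linarith

/-- The region of the `(q, k)` plane swept by the orbits. -/
def modulusRegion : Set (ℝ × ℝ) := {z | |sin (z.1 / 2)| < z.2}

theorem measurableSet_modulusRegion : MeasurableSet modulusRegion :=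
  measurableSet_lt (by fun_prop) measurable_snd

/-- Fubini with `k` outermost. The slice of the region is `|q| < 2 arcsin k` for `0 < k < 1`, the
full circle for `k > 1` and empty for `k ≤ 0`; the line `k = 1` is null. -/
theorem integral_modulusRegion_eq {ψ : ℝ → ℝ → ℝ}
    (hψ : IntegrableOn (modulusRegion.indicator (Function.uncurry ψ)) phaseSpace) :
    ∫ z in phaseSpace, modulusRegion.indicator (Function.uncurry ψ) z = modulusIntegral ψ := by
  rw [IntegrableOn, restrict_phaseSpace] at hψ
  rw [restrict_phaseSpace, integral_prod_symm _ hψ]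
  have hi := hψ.integral_prod_right
  set J : ℝ → ℝ := fun k =>
    ∫ q in Ioc (-π) π, modulusRegion.indicator (Function.uncurry ψ) (q, k) with hJ
  have h0 : ∀ k, k ∉ Ioi (0 : ℝ) → J k = 0 := by
    intro k hk
    refine integral_eq_zero_of_ae (Eventually.of_forall fun q => indicator_of_notMem ?_ _)
    intro h
    exact hk (mem_Ioi.2 ((abs_nonneg _).trans_lt h))
  have hU : Ioi (0 : ℝ) = Ioo 0 1 ∪ Ici 1 := (Ioo_union_Ici_eq_Ioi zero_lt_one).symm
  have hd : Disjoint (Ioo (0 : ℝ) 1) (Ici 1) :=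
    disjoint_left.2 fun x hx hx' => absurd hx.2 (not_lt.2 hx')
  rw [← setIntegral_eq_integral_of_forall_compl_eq_zero h0, hU, setIntegral_union hd
      measurableSet_Ici hi.integrableOn hi.integrableOn, integral_Ici_eq_integral_Ioi,
    modulusIntegral]
  congr 1
  · refine setIntegral_congr_fun measurableSet_Ioo fun k hk => ?_
    have hk0 : 0 ≤ arcsin k := arcsin_nonneg.2 hk.1.le
    have hk1 := arcsin_le_pi_div_two k
    have hsub : Ioo (-(2 * arcsin k)) (2 * arcsin k) ⊆ Ioc (-π) π := fun q hq =>
      ⟨by linarith [hq.1], by linarith [hq.2]⟩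
    simp only [hJ]
    rw [intervalIntegral.integral_of_le (by linarith),
      setIntegral_eq_of_subset_of_forall_sdiff_eq_zero measurableSet_Ioc hsub
        (f := fun q => modulusRegion.indicator (Function.uncurry ψ) (q, k)),
      integral_Ioc_eq_integral_Ioo]
    · refine setIntegral_congr_fun measurableSet_Ioo fun q hq => ?_
      exact indicator_of_mem
        (show (q, k) ∈ modulusRegion from (abs_sin_half_lt_iff hk (hsub hq)).2 hq) _
    · intro q hq
      exact indicator_of_notMem
        (fun h : (q, k) ∈ modulusRegion => hq.2 ((abs_sin_half_lt_iff hk hq.1).1 h)) _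
  · refine setIntegral_congr_fun measurableSet_Ioi fun k hk => ?_
    rw [intervalIntegral.integral_of_le (by linarith [pi_pos])]
    refine setIntegral_congr_fun measurableSet_Ioc fun q _ => ?_
    exact indicator_of_mem
      (show (q, k) ∈ modulusRegion from (abs_sin_le_one _).trans_lt hk) _

/-- The factor `4√M` is 2 for the two signs of `p` times `2√M` from the Jacobian. -/
theorem integral_phaseSpace_eq_modulusIntegral {M : ℝ} (hM : 0 < M) {F : ℝ × ℝ → ℝ}
    {ψ : ℝ → ℝ → ℝ} (hF : IntegrableOn F phaseSpace)
    (heven : ∀ q ∈ Ioc (-π) π, ∀ p, F (q, |p|) = F (q, p))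
    (hψm : AEStronglyMeasurable (Function.uncurry ψ) (volume.restrict phaseSpace))
    (hψ : ∀ q ∈ Ioc (-π) π, ∀ k, |sin (q / 2)| < k →
      F (q, 2 * √M * √(k ^ 2 - sin (q / 2) ^ 2)) / √(1 - sin (q / 2) ^ 2 / k ^ 2) = ψ q k) :
    ∫ z in phaseSpace, F z = 4 * √M * modulusIntegral ψ := by
  set c := 2 * √M with hc
  have hc0 : 0 < c := by positivity
  set Ψ := modulusRegion.indicator (Function.uncurry ψ) with hΨ
  have hcov : ∀ q ∈ Ioc (-π) π, ∀ k ∈ Ioi |sin (q / 2)|,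
      c / √(1 - |sin (q / 2)| ^ 2 / k ^ 2) * F (q, c * √(k ^ 2 - |sin (q / 2)| ^ 2)) =
        c * ψ q k := by
    intro q hq k hk
    rw [sq_abs, ← hψ q hq k hk]; ring
  have hslice : ∀ q, (fun k => Ψ (q, k)) = (Ioi |sin (q / 2)|).indicator (ψ q) := fun q => rfl
  have hint : ∀ q ∈ Ioc (-π) π, ∫ p, F (q, p) = 2 * c * ∫ k, Ψ (q, k) := by
    intro q hq
    rw [← integral_congr_ae (Eventually.of_forall (heven q hq)),
      integral_comp_abs (f := fun p => F (q, p)),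
      integral_Ioi_zero_eq_integral_modulus hc0 (abs_nonneg _),
      setIntegral_congr_fun measurableSet_Ioi (hcov q hq), integral_const_mul, hslice,
      integral_indicator measurableSet_Ioi]
    ring
  have hnorm : ∀ q ∈ Ioc (-π) π, ∫ p, ‖F (q, p)‖ = 2 * c * ∫ k, ‖Ψ (q, k)‖ := by
    intro q hq
    have h1 : ∀ p, ‖F (q, |p|)‖ = ‖F (q, p)‖ := fun p => by rw [heven q hq]
    have h2 : (fun k => ‖Ψ (q, k)‖) = (Ioi |sin (q / 2)|).indicator fun k => ‖ψ q k‖ := by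
      ext k
      exact (congrArg norm (congrFun (hslice q) k)).trans (norm_indicator_eq_indicator_norm _ _)
    rw [← integral_congr_ae (Eventually.of_forall h1),
      integral_comp_abs (f := fun p => ‖F (q, p)‖),
      integral_Ioi_zero_eq_integral_modulus hc0 (abs_nonneg _), h2,
      integral_indicator measurableSet_Ioi, mul_assoc, ← integral_const_mul c]
    congr 1
    refine setIntegral_congr_fun measurableSet_Ioi fun k hk => ?_
    have h3 := congrArg norm (hcov q hq k hk)
    rw [norm_mul, norm_mul, norm_of_nonneg (by positivity), norm_of_nonneg hc0.le] at h3
    exact h3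
  have hF' := hF
  rw [IntegrableOn, restrict_phaseSpace] at hF'
  -- Integrability passes from `F` to `Ψ`: on each slice the integrals of the norms agree up to the
  -- factor `2c`.
  have hΨi : IntegrableOn Ψ phaseSpace := by
    have hm := hψm.indicator measurableSet_modulusRegion
    rw [restrict_phaseSpace] at hm
    rw [IntegrableOn, restrict_phaseSpace, integrable_prod_iff hm]
    constructor
    · filter_upwards [hF'.prod_right_ae, ae_restrict_mem measurableSet_Ioc] with q h1 hq
      have h2 := (integrableOn_Ioi_zero_iff_modulus hc0 (abs_nonneg (sin (q / 2)))
        (fun p => F (q, p))).1 h1.integrableOn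
      rw [integrableOn_congr_fun (hcov q hq) measurableSet_Ioi] at h2
      refine ((integrable_indicator_iff measurableSet_Ioi).2 (h2.const_mul c⁻¹)).congr ?_
      refine Eventually.of_forall fun k => ?_
      simp only [← hΨ, congrFun (hslice q) k, inv_mul_cancel_left₀ hc0.ne']
    · refine (hF'.norm.integral_prod_left.const_mul (2 * c)⁻¹).congr ?_
      filter_upwards [ae_restrict_mem measurableSet_Ioc] with q hq
      rw [hnorm q hq, inv_mul_cancel_left₀ (by positivity)]
  rw [← integral_modulusRegion_eq hΨi, restrict_phaseSpace, integral_prod _ hF',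
    setIntegral_congr_fun measurableSet_Ioc hint, integral_const_mul, integral_prod]
  · rw [hc]; ring
  · rwa [IntegrableOn, restrict_phaseSpace] at hΨi

theorem modulusIntegral_const_mul (a : ℝ) (ψ : ℝ → ℝ → ℝ) :
    modulusIntegral (fun q k => a * ψ q k) = a * modulusIntegral ψ := by
  simp only [modulusIntegral, intervalIntegral.integral_const_mul, integral_const_mul]
  ring

theorem cosAverage_abs {M : ℝ} (hM : 0 < M) (q p : ℝ) :
    cosAverage M q |p| = cosAverage M q p := by
  rw [cosAverage_eq_reducedAverage hM, cosAverage_eq_reducedAverage hM, sq_abs]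

theorem cosAverageModulus_eq (k : ℝ) :
    cosAverageModulus k = reducedAverage (2 * k ^ 2 - 1) := by
  rw [cosAverageModulus, cosAverage_eq_reducedAverage one_pos, cos_zero]
  congr 1; ring

theorem measurable_cosAverageModulus : Measurable cosAverageModulus := by
  rw [funext cosAverageModulus_eq]
  exact measurable_reducedAverage.comp (by fun_prop)

theorem sq_modulus_momentum {M q k : ℝ} (hM : 0 < M) (hk : |sin (q / 2)| < k) :
    (2 * √M * √(k ^ 2 - sin (q / 2) ^ 2)) ^ 2 / (2 * M) = 2 * k ^ 2 - 1 + cos q := by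
  have h0 : 0 ≤ k ^ 2 - sin (q / 2) ^ 2 := by
    rw [← sq_abs (sin _)]
    have := abs_nonneg (sin (q / 2))
    nlinarith
  have h1 : cos q = 1 - 2 * sin (q / 2) ^ 2 := by
    have h2 := cos_two_mul (q / 2)
    rw [mul_div_cancel₀ q two_ne_zero] at h2
    linarith [sin_sq_add_cos_sq (q / 2)]
  rw [mul_pow, mul_pow, sq_sqrt hM.le, sq_sqrt h0, h1]
  field_simp; ring

theorem cosAverage_modulus_momentum {M q k : ℝ} (hM : 0 < M) (hk : |sin (q / 2)| < k) :
    cosAverage M q (2 * √M * √(k ^ 2 - sin (q / 2) ^ 2)) = cosAverageModulus k := by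
  rw [cosAverage_eq_reducedAverage hM, sq_modulus_momentum hM hk, cosAverageModulus_eq]
  congr 1; ring

namespace AdmissibleInitial

theorem coeffHalf_eq {f : ℝ → ℝ → ℝ} (hf : AdmissibleInitial f) {M : ℝ} (hM : 0 < M) :
    coeffHalf f M = 4 * modulusIntegral (psiHalf f) := by
  have h0 : Measurable fun z : ℝ × ℝ => f z.1 0 :=
    hf.measurable.comp (by fun_prop : Measurable fun z : ℝ × ℝ => (z.1, (0 : ℝ)))
  have h1 : Measurable fun z : ℝ × ℝ => √(1 - sin (z.1 / 2) ^ 2 / z.2 ^ 2) := by fun_prop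
  have hm : Measurable (Function.uncurry (psiHalf f)) :=
    (h0.mul (measurable_cosAverageModulus.comp measurable_snd)).div h1
  rw [coeffHalf, integral_phaseSpace_eq_modulusIntegral hM (ψ := psiHalf f)
    (hf.integrableOn_zero_mul_cosAverage hM) (fun q _ p => by simp only [cosAverage_abs hM])
    hm.aestronglyMeasurable (fun q _ k hk => by
      simp only [cosAverage_modulus_momentum hM hk, psiHalf]), rpow_neg hM.le, ← sqrt_eq_rpow]
  have := sqrt_pos.2 hM
  field_simp

/-- Here `p² / 2 = M (2k² - 1 + cos q)`, so the integrand carries a factor `M`; with the `√M` of the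
Jacobian it cancels `M^(-3/2)`. -/
theorem coeffThreeHalves_eq {f : ℝ → ℝ → ℝ} (hf : AdmissibleInitial f) {M : ℝ} (hM : 0 < M) :
    coeffThreeHalves f M = 4 * modulusIntegral (psiThreeHalves f) := by
  have h1 : Measurable fun z : ℝ × ℝ => √(1 - sin (z.1 / 2) ^ 2 / z.2 ^ 2) := by fun_prop
  have h2 : Measurable fun z : ℝ × ℝ => M * (((2 * z.2 ^ 2 - 1 + cos z.1) *
      cosAverageModulus z.2 + 1 / 4) / √(1 - sin (z.1 / 2) ^ 2 / z.2 ^ 2)) :=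
    ((((by fun_prop : Measurable fun z : ℝ × ℝ => 2 * z.2 ^ 2 - 1 + cos z.1).mul
      (measurable_cosAverageModulus.comp measurable_snd)).add_const _).div h1).const_mul M
  have hm : AEStronglyMeasurable (Function.uncurry fun q k => M * psiThreeHalves f q k)
      (volume.restrict phaseSpace) := by
    refine ((hf.aestronglyMeasurable_pDeriv_zero 2).mul h2.aestronglyMeasurable).congr
      (Eventually.of_forall fun z => ?_)
    simp only [Function.uncurry, psiThreeHalves, Pi.mul_apply]
    ring
  rw [coeffThreeHalves, integral_phaseSpace_eq_modulusIntegral hM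
    (ψ := fun q k => M * psiThreeHalves f q k)
    (hf.integrableOn_pDeriv_two_mul hM) (fun q _ p => by simp only [cosAverage_abs hM, sq_abs])
    hm (fun q _ k hk => ?_), modulusIntegral_const_mul, rpow_neg hM.le,
    show (3 / 2 : ℝ) = 1 + 1 / 2 by norm_num, rpow_add hM, rpow_one, ← sqrt_eq_rpow]
  · have := sqrt_pos.2 hM
    field_simp
  · have h3 := sq_modulus_momentum hM hk
    simp only [cosAverage_modulus_momentum hM hk, psiThreeHalves]
    rw [div_eq_iff (by positivity)] at h3
    rw [h3]
    ring

end AdmissibleInitial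

/-! ### The main theorem -/

theorem mainTheorem1 (f₀ : ℝ → ℝ → ℝ) (hf : AdmissibleInitial f₀) :
    -- all the integrals exist
    (∀ M : ℝ, 0 < M →
      IntegrableOn (fun z : ℝ × ℝ => cosAverage M z.1 z.2 * f₀ z.1 z.2) phaseSpace ∧
      IntegrableOn (fun z : ℝ × ℝ => f₀ z.1 0 * cosAverage M z.1 z.2) phaseSpace ∧
      IntegrableOn (fun z : ℝ × ℝ =>
        pDeriv 2 f₀ z.1 0 * (z.2 ^ 2 / 2 * cosAverage M z.1 z.2 + M / 4)) phaseSpace) ∧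
    (∀ R : ℝ, IntegrableOn (fun z : ℝ × ℝ => pDeriv 1 f₀ z.1 z.2 / z.2)
      (Ioc (-π) π ×ˢ Ioo (-R) R)) ∧
    Tendsto (coeffOneTruncated f₀) atTop (𝓝 (coeffOne f₀)) ∧
    (IntegrableOn (fun z : ℝ × ℝ => pDeriv 1 f₀ z.1 z.2 / z.2) phaseSpace →
      coeffOne f₀ = -(1 / 2) * ∫ z in phaseSpace, pDeriv 1 f₀ z.1 z.2 / z.2) ∧
    -- `L_{1/2}` and `L_{3/2}` do not depend on `M`
    (∀ M : ℝ, 0 < M →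
      coeffHalf f₀ M = 4 * modulusIntegral (psiHalf f₀) ∧
      coeffThreeHalves f₀ M = 4 * modulusIntegral (psiThreeHalves f₀)) ∧
    -- the expansion of the integral
    ((fun M : ℝ => magnetizationIntegral f₀ M - expansion f₀ M) =O[𝓝[>] 0]
      fun M : ℝ => M ^ (7 / 4 : ℝ)) ∧
    -- the expansion of the self-consistent equation
    (∃ C δ : ℝ, 0 < δ ∧ ∀ M h : ℝ, 0 < M → 0 ≤ h → M + h < δ →
      M = magnetizationIntegral f₀ (M + h) →
      |M - expansion f₀ (M + h)| ≤ C * (M + h) ^ (7 / 4 : ℝ)) := by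
  refine ⟨fun M hM => ⟨hf.integrableOn_cosAverage_mul hM, hf.integrableOn_zero_mul_cosAverage hM,
    hf.integrableOn_pDeriv_two_mul hM⟩, hf.integrableOn_pDeriv_one_div, ?_,
    coeffOne_eq_of_integrableOn, fun M hM => ⟨hf.coeffHalf_eq hM, hf.coeffThreeHalves_eq hM⟩,
    ?_, ?_⟩
  · rw [hf.coeffOne_eq]
    exact hf.tendsto_coeffOneTruncated
  · obtain ⟨K, hK⟩ := hf.exists_abs_magnetizationIntegral_sub_expansion_le_rpow
    refine IsBigO.of_bound K ?_
    filter_upwards [Ioo_mem_nhdsGT (zero_lt_one' ℝ)] with M hM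
    rw [norm_eq_abs, norm_of_nonneg (rpow_nonneg hM.1.le _)]
    exact hK M hM.1 hM.2
  · obtain ⟨K, hK⟩ := hf.exists_abs_magnetizationIntegral_sub_expansion_le_rpow
    -- `δ = 1` suffices: the bound holds on all of `(0, 1)`, where `M² ≤ M^(7/4)`.
    refine ⟨K, 1, one_pos, fun M h hM hh hlt hself => ?_⟩
    have := hK (M + h) (by linarith) hlt
    rwa [← hself] at this
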